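/- Let $A=\mathbb C[z_1,\dots,z_m]$. A Hilbert $A$-module is a complex Hilbert space $M$ with a unital representation $p\mapsto T_p$ of $A$ by bounded operators on $M$; it is essentially normal if $[T_{z_i}^*,T_{z_j}]$ is compact for all $i,j$. Write $\mathcal C(M)=B(M)/\mathcal K(M)$ for the Calkin algebra. For $M$ essentially normal, the unital $C^*$-subalgebra of $\mathcal C(M)$ generated by the classes of $T_{z_1},\dots,T_{z_m}$ (the image of the unital $C^*$-algebra $\mathfrak T(M)$ generated by the operators $T_{z_i}$) is commutative. Its character space, embedded in $\mathbb C^m$ by evaluation at these classes, is the essential spectrum $\sigma^e(M)\subset\mathbb C^m$, and $\alpha_M: C(\sigma^e(M))\to\mathcal C(M)$ denotes the inverse Gelfand isomorphism followed by the inclusion; it is the unique unital $*$-homomorphism sending the coordinate function $z_i$ to the class of $T_{z_i}$. For a compact metrizable space $X$, let $K_1(X)=\mathrm{Ext}(X)$ be the odd K-homology group of Brown, Douglas and Fillmore: unital $*$-homomorphisms $\tau: C(X)\to\mathcal C(H)$, $H$ a Hilbert space, where $\tau\sim\tau'$ if $\tau\oplus\rho$ and $\tau'\oplus\rho'$ are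 conjugate by a unitary operator for some $\rho,\rho'$ that lift to $*$-homomorphisms into bounded operators; addition is the direct sum, and a continuous map $g:X\to Y$ induces $g_*[\tau]=[f\mapsto\tau(f\circ g)]$. Let $M_1,M_2,M_3$ be essentially normal Hilbert $A$-modules and let $$0\longrightarrow M_1\xrightarrow{\ W_1\ }M_2\xrightarrow{\ W_2\ }M_3\longrightarrow 0$$ be a short exact sequence of bounded $A$-module maps. Write $\sigma_i^e=\sigma^e(M_i)$ and $\alpha_i=\alpha_{M_i}$. Then $\sigma_1^e\subseteq\sigma_2^e$ and $\sigma_3^e\subseteq\sigma_2^e$, and there are bounded operators $U:M_2\to M_1$ and $V:M_2\to M_3$ with $$UU^*=I=VV^*,\qquad UV^*=0=VU^*,\qquad U^*U+V^*V=I,$$ such that for every $f\in C(\sigma_2^e)$ $$U\alpha_2(f)U^*=\alpha_1(f|_{\sigma_1^e}),\qquad V\alpha_2(f)V^*=\alpha_3(f|_{\sigma_3^e}).$$ Moreover, regarding $[\alpha_1]$ and $[\alpha_3]$ as classes in $K_1(\sigma_2^e)$, namely as the classes of the homomorphisms $U\alpha_2U^*$ and $V\alpha_2V^*$ of $C(\sigma_2^e)$,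 that is, as the push-forwards of $[\alpha_1]$ and $[\alpha_3]$ along the inclusions $\sigma_1^e,\sigma_3^e\subseteq\sigma_2^e$, one has $$[\alpha_2]=[\alpha_1]+[\alpha_3]\quad\text{in }K_1(\sigma_2^e).$$ -/

import Mathlib

universe u v

open ContinuousLinearMap WithLp

noncomputable section

namespace EssNormal

section Calkin

variable {H K L : Type*}
  [NormedAddCommGroup H] [InnerProductSpace ℂ H] [CompleteSpace H]
  [NormedAddCommGroup K] [InnerProductSpace ℂ K] [CompleteSpace K]
  [NormedAddCommGroup L] [InnerProductSpace ℂ L] [CompleteSpace L]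

/-- A compact operator is approximated by its compressions to finite-rank projections. -/
theorem exists_projection_approx {a : H →L[ℂ] K} (ha : IsCompactOperator a) {ε : ℝ}
    (hε : 0 < ε) : ∃ P : K →L[ℂ] K, IsCompactOperator P ∧ adjoint P = P ∧ ‖1 - P‖ ≤ 1 ∧
      ‖a - P ∘L a‖ ≤ ε := by
  have hc := (ha.isCompact_closure_image_closedBall (𝕜₁ := ℂ) (f := (a : H →ₗ[ℂ] K)) 1)
  obtain ⟨t, -, ht, hcov⟩ := (hc.totallyBounded.subset subset_closure).exists_subset
    (Metric.dist_mem_uniformity hε)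
  let S : Submodule ℂ K := Submodule.span ℂ t
  have : FiniteDimensional ℂ S := FiniteDimensional.span_of_finite ℂ ht
  refine ⟨S.starProjection, ?_, ?_, ?_, ?_⟩
  · have : IsCompactOperator S.orthogonalProjectionOnto :=
      isCompactOperator_of_locallyCompactSpace_dom S.orthogonalProjectionOnto
    exact this.clm_comp S.subtypeL
  · exact (isSelfAdjoint_starProjection S)
  · rw [← Submodule.starProjection_orthogonal']
    exact Submodule.starProjection_norm_le _
  · refine opNorm_le_of_unit_norm hε.le fun x hx => ?_
    have hx' : a x ∈ (a : H →ₗ[ℂ] K) '' Metric.closedBall 0 1 :=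
      ⟨x, by simp [hx], rfl⟩
    obtain ⟨y, hy, hxy⟩ := Set.mem_iUnion₂.1 (hcov hx')
    have hyS : y ∈ S := Submodule.subset_span hy
    have h1 : a x - S.starProjection (a x) = Sᗮ.starProjection (a x - y) := by
      rw [map_sub, (Submodule.starProjection_apply_eq_zero_iff Sᗮ).2
        (S.le_orthogonal_orthogonal hyS), sub_zero, Submodule.starProjection_orthogonal']
      simp
    have h2 : ‖Sᗮ.starProjection (a x - y)‖ ≤ ‖a x - y‖ :=
      Submodule.norm_starProjection_apply_le _ _
    have h3 : ‖a x - y‖ < ε := by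
      have := hxy
      simpa [dist_eq_norm] using this
    simpa [h1] using h2.trans h3.le

/-- The adjoint of a compact operator between Hilbert spaces is compact. -/
theorem isCompactOperator_adjoint {a : H →L[ℂ] K} (ha : IsCompactOperator a) :
    IsCompactOperator (adjoint a) := by
  refine (isClosed_setOfPred_isCompactOperator (σ₁₂ := RingHom.id ℂ) (M₁ := K)
    (M₂ := H)).closure_subset (Metric.mem_closure_iff.2 fun ε hε => ?_)
  obtain ⟨P, hPc, hPs, -, hP⟩ := exists_projection_approx ha (half_pos hε)
  refine ⟨adjoint a ∘L P, hPc.clm_comp (adjoint a), ?_⟩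
  have : adjoint a - adjoint a ∘L P = adjoint (a - P ∘L a) := by
    rw [map_sub, adjoint_comp, hPs]
  rw [dist_eq_norm, this, LinearIsometryEquiv.norm_map]
  linarith

variable (H) in
/-- The two-sided ideal `𝒦(H)` of compact operators in `B(H)`. -/
def compactIdeal : Ideal (H →L[ℂ] H) where
  carrier := {a | IsCompactOperator a}
  add_mem' ha hb := IsCompactOperator.add ha hb
  zero_mem' := isCompactOperator_zero
  smul_mem' a _ hb := IsCompactOperator.clm_comp hb a

instance : (compactIdeal H).IsTwoSided :=
  ⟨fun b ha => IsCompactOperator.comp_clm ha b⟩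

instance : IsClosed ((compactIdeal H : Ideal (H →L[ℂ] H)) : Set (H →L[ℂ] H)) :=
  isClosed_setOfPred_isCompactOperator

variable (H) in
/-- The Calkin algebra `𝒞(H) = B(H)/𝒦(H)`. -/
abbrev Calkin : Type _ := (H →L[ℂ] H) ⧸ compactIdeal H

namespace Calkin

/-- The involution of the Calkin algebra, `[a]⋆ = [a⋆]`. -/
instance : StarRing (Calkin H) where
  star := Quotient.map' (s₁ := (compactIdeal H).quotientRel) (s₂ := (compactIdeal H).quotientRel)
    (fun a => star a) fun a b hab => by
      rw [Submodule.quotientRel_def] at hab ⊢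
      rw [← star_sub]
      exact isCompactOperator_adjoint hab
  star_involutive x := by
    induction x using Submodule.Quotient.induction_on with
    | _ a => exact congrArg Submodule.Quotient.mk (star_star a)
  star_mul x y := by
    induction x using Submodule.Quotient.induction_on with
    | _ a =>
      induction y using Submodule.Quotient.induction_on with
      | _ b => exact congrArg Submodule.Quotient.mk (star_mul a b)
  star_add x y := by
    induction x using Submodule.Quotient.induction_on with
    | _ a =>
      induction y using Submodule.Quotient.induction_on with
      | _ b => exact congrArg Submodule.Quotient.mk (star_add a b)

variable (H) in
/-- The quotient map `B(H) → 𝒞(H)`. -/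
def mk : (H →L[ℂ] H) →⋆ₐ[ℂ] Calkin H where
  toAlgHom := Ideal.Quotient.mkₐ ℂ (compactIdeal H)
  map_star' _ := rfl

theorem mk_surjective : Function.Surjective (mk H) := Ideal.Quotient.mk_surjective

theorem mk_eq_mk {a b : H →L[ℂ] H} : mk H a = mk H b ↔ IsCompactOperator (a - b) :=
  Ideal.Quotient.mk_eq_mk_iff_sub_mem a b

theorem mk_eq_zero {a : H →L[ℂ] H} : mk H a = 0 ↔ IsCompactOperator a :=
  Ideal.Quotient.eq_zero_iff_mem

theorem norm_mk_le (a : H →L[ℂ] H) : ‖mk H a‖ ≤ ‖a‖ :=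
  QuotientAddGroup.norm_mk_le_norm (S := (compactIdeal H).toAddSubgroup)

theorem exists_norm_lt (x : Calkin H) {ε : ℝ} (hε : 0 < ε) :
    ∃ a : H →L[ℂ] H, mk H a = x ∧ ‖a‖ < ‖x‖ + ε :=
  QuotientAddGroup.exists_norm_mk_lt (S := (compactIdeal H).toAddSubgroup) x hε

theorem norm_mul_le' (x y : Calkin H) : ‖x * y‖ ≤ ‖x‖ * ‖y‖ := by
  have key : ∀ ε > 0, ‖x * y‖ ≤ (‖x‖ + ε) * (‖y‖ + ε) := fun ε hε => by
    obtain ⟨a, rfl, ha⟩ := exists_norm_lt x hε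
    obtain ⟨b, rfl, hb⟩ := exists_norm_lt y hε
    rw [← map_mul]
    exact (norm_mk_le _).trans ((norm_mul_le _ _).trans (by gcongr))
  have hlim : Filter.Tendsto (fun ε : ℝ => (‖x‖ + ε) * (‖y‖ + ε)) (nhdsWithin 0 (Set.Ioi 0))
      (nhds ((‖x‖ + 0) * (‖y‖ + 0))) :=
    ((Continuous.tendsto (by fun_prop) 0).mono_left nhdsWithin_le_nhds)
  simpa using ge_of_tendsto hlim (Filter.eventually_of_mem self_mem_nhdsWithin key)

theorem norm_mul_self_le' (x : Calkin H) : ‖x‖ * ‖x‖ ≤ ‖star x * x‖ := by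
  refine le_of_forall_pos_le_add fun ε hε => ?_
  obtain ⟨a, rfl⟩ := mk_surjective x
  obtain ⟨b, hb, hbn⟩ := exists_norm_lt (star (mk H a) * mk H a) (half_pos hε)
  rw [← map_star, ← map_mul, eq_comm, mk_eq_mk] at hb
  obtain ⟨P, hPc, hPs, hP1, hP⟩ := exists_projection_approx hb (half_pos hε)
  have h1 : ‖mk H a‖ ≤ ‖a * (1 - P)‖ := by
    have : mk H a = mk H (a * (1 - P)) := by
      rw [mk_eq_mk]
      have : a - a * (1 - P) = a ∘L P := by rw [mul_sub, mul_one, sub_sub_cancel]; rfl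
      rw [this]
      exact hPc.clm_comp a
    rw [this]
    exact norm_mk_le _
  have hs : star (1 - P) = 1 - P := by rw [star_sub, star_one]; congr 1
  set k := star a * a - b with hk
  have h2 : ‖a * (1 - P)‖ * ‖a * (1 - P)‖ ≤ ‖b‖ + ε / 2 := by
    rw [← CStarRing.norm_star_mul_self, star_mul, hs]
    have e : (1 - P) * star a * (a * (1 - P)) = (1 - P) * b * (1 - P) + (k - P * k) * (1 - P) := by
      rw [hk]; noncomm_ring
    rw [e]
    refine (norm_add_le _ _).trans (add_le_add ?_ ?_)
    · calc _ ≤ ‖1 - P‖ * ‖b‖ * ‖1 - P‖ := norm_mul₃_le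
        _ ≤ 1 * ‖b‖ * 1 := by gcongr
        _ = ‖b‖ := by ring
    · calc _ ≤ ‖k - P * k‖ * ‖1 - P‖ := norm_mul_le _ _
        _ ≤ ε / 2 * 1 := by gcongr; exact hP
        _ = ε / 2 := by ring
  calc _ ≤ ‖a * (1 - P)‖ * ‖a * (1 - P)‖ := by gcongr
    _ ≤ _ := by linarith

/-- The Calkin algebra with its quotient norm is a C⋆-algebra. -/
instance : CStarAlgebra (Calkin H) where
  __ := (inferInstance : NormedAddCommGroup (Calkin H))
  __ := (inferInstance : Ring (Calkin H))
  __ := (inferInstance : StarRing (Calkin H))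
  __ := (inferInstance : Algebra ℂ (Calkin H))
  norm_mul_le := norm_mul_le'
  norm_mul_self_le := norm_mul_self_le'
  norm_smul_le := (inferInstance : NormedSpace ℂ (Calkin H)).norm_smul_le
  complete := (inferInstance : CompleteSpace (Calkin H)).complete
  star_smul c x := by
    obtain ⟨a, rfl⟩ := mk_surjective x
    rw [← map_smul, ← map_star, star_smul, map_smul, ← map_star]


variable (H) in
theorem star_mk (a : H →L[ℂ] H) : star (mk H a) = mk H (adjoint a) := rfl

/-- Compression by a bounded operator `W : H → K`: the map `[a] ↦ [W a W⋆]`, written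
`a ↦ W a W⋆`, from `𝒞(H)` to `𝒞(K)`. -/
def conj (W : H →L[ℂ] K) : Calkin H →ₗ[ℂ] Calkin K where
  toFun := Quotient.lift (s := (compactIdeal H).quotientRel)
    (fun a => mk K (W ∘L a ∘L adjoint W)) fun a b hab => by
      have hab' : IsCompactOperator (a - b) :=
        ((compactIdeal H).quotientRel_def).1 hab
      rw [mk_eq_mk]
      have : W ∘L a ∘L adjoint W - W ∘L b ∘L adjoint W = W ∘L (a - b) ∘L adjoint W := by
        rw [sub_comp, comp_sub]
      rw [this]
      exact (hab'.comp_clm (adjoint W)).clm_comp W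
  map_add' x y := by
    induction x using Submodule.Quotient.induction_on with
    | _ a =>
      induction y using Submodule.Quotient.induction_on with
      | _ b =>
        change mk K (W ∘L (a + b) ∘L adjoint W) =
          mk K (W ∘L a ∘L adjoint W) + mk K (W ∘L b ∘L adjoint W)
        rw [← map_add, add_comp, comp_add]
  map_smul' c x := by
    induction x using Submodule.Quotient.induction_on with
    | _ a =>
      change mk K (W ∘L (c • a) ∘L adjoint W) = c • mk K (W ∘L a ∘L adjoint W)
      rw [← map_smul, smul_comp, comp_smul]

theorem conj_mk (W : H →L[ℂ] K) (a : H →L[ℂ] H) :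
    conj W (mk H a) = mk K (W ∘L a ∘L adjoint W) := rfl

theorem conj_conj (V : K →L[ℂ] L) (W : H →L[ℂ] K) (x : Calkin H) :
    conj V (conj W x) = conj (V ∘L W) x := by
  obtain ⟨a, rfl⟩ := mk_surjective x
  simp only [conj_mk, adjoint_comp, comp_assoc]

theorem conj_id (x : Calkin H) : conj (.id ℂ H) x = x := by
  obtain ⟨a, rfl⟩ := mk_surjective x
  rw [conj_mk, adjoint_id, comp_id, id_comp]

theorem conj_star (W : H →L[ℂ] K) (x : Calkin H) : conj W (star x) = star (conj W x) := by
  obtain ⟨a, rfl⟩ := mk_surjective x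
  simp only [conj_mk, star_mk, adjoint_comp, adjoint_adjoint, comp_assoc]

theorem conj_one (W : H →L[ℂ] K) : conj W (1 : Calkin H) = mk K (W ∘L adjoint W) := rfl

theorem conj_mul {W : H →L[ℂ] K} (hW : adjoint W ∘L W = .id ℂ H) (x y : Calkin H) :
    conj W (x * y) = conj W x * conj W y := by
  obtain ⟨a, rfl⟩ := mk_surjective x
  obtain ⟨b, rfl⟩ := mk_surjective y
  simp only [← map_mul, conj_mk, mul_def, comp_assoc]
  rw [← comp_assoc (adjoint W) W, hW, id_comp]

theorem conj_mul_conj {W : H →L[ℂ] L} {V : K →L[ℂ] L} (h : adjoint W ∘L V = 0)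
    (x : Calkin H) (y : Calkin K) : conj W x * conj V y = 0 := by
  obtain ⟨a, rfl⟩ := mk_surjective x
  obtain ⟨b, rfl⟩ := mk_surjective y
  simp only [← map_mul, conj_mk, mul_def, comp_assoc]
  rw [← comp_assoc (adjoint W) V, h]
  simp

end Calkin

end Calkin

/-! ### Orthogonal direct sums of Hilbert spaces -/

section DirectSum

variable (H K : Type*)
  [NormedAddCommGroup H] [InnerProductSpace ℂ H] [NormedAddCommGroup K] [InnerProductSpace ℂ K]

/-- The isometric inclusion of the first summand in the orthogonal direct sum. -/
def inl : H →L[ℂ] WithLp 2 (H × K) :=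
  (prodContinuousLinearEquiv 2 ℂ H K).symm.toContinuousLinearMap ∘L .inl ℂ H K

/-- The isometric inclusion of the second summand in the orthogonal direct sum. -/
def inr : K →L[ℂ] WithLp 2 (H × K) :=
  (prodContinuousLinearEquiv 2 ℂ H K).symm.toContinuousLinearMap ∘L .inr ℂ H K

variable {H K}

@[simp] theorem inl_apply (x : H) : inl H K x = toLp 2 (x, 0) := rfl
@[simp] theorem inr_apply (x : K) : inr H K x = toLp 2 (0, x) := rfl

variable [CompleteSpace H] [CompleteSpace K]

@[simp] theorem adjoint_inl_apply (x : WithLp 2 (H × K)) : adjoint (inl H K) x = x.fst :=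
  ext_inner_left ℂ fun y => by simp [adjoint_inner_right, prod_inner_apply]

@[simp] theorem adjoint_inr_apply (x : WithLp 2 (H × K)) : adjoint (inr H K) x = x.snd :=
  ext_inner_left ℂ fun y => by simp [adjoint_inner_right, prod_inner_apply]

theorem adjoint_inl_inl : adjoint (inl H K) ∘L inl H K = .id ℂ H := by ext; simp
theorem adjoint_inr_inr : adjoint (inr H K) ∘L inr H K = .id ℂ K := by ext; simp
theorem adjoint_inl_inr : adjoint (inl H K) ∘L inr H K = 0 := by ext; simp
theorem adjoint_inr_inl : adjoint (inr H K) ∘L inl H K = 0 := by ext; simp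

theorem inl_add_inr :
    inl H K ∘L adjoint (inl H K) + inr H K ∘L adjoint (inr H K) = .id ℂ (WithLp 2 (H × K)) := by
  refine ContinuousLinearMap.ext fun x => ofLp_injective 2 (Prod.ext ?_ ?_) <;> simp

end DirectSum

/-! ### Extensions of `C(X)` by compact operators -/

section Busby

variable {X : Type*} [TopologicalSpace X] {H K L H' K' : Type*}
  [NormedAddCommGroup H] [InnerProductSpace ℂ H] [CompleteSpace H]
  [NormedAddCommGroup K] [InnerProductSpace ℂ K] [CompleteSpace K]
  [NormedAddCommGroup L] [InnerProductSpace ℂ L] [CompleteSpace L]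
  [NormedAddCommGroup H'] [InnerProductSpace ℂ H'] [CompleteSpace H']
  [NormedAddCommGroup K'] [InnerProductSpace ℂ K'] [CompleteSpace K']

variable (X H) in
/-- A unital extension of `C(X)` by compact operators on `H`, given by its Busby invariant: a
unital `⋆`-homomorphism `C(X) → 𝒞(H)` to the Calkin algebra. -/
abbrev Busby : Type _ := C(X, ℂ) →⋆ₐ[ℂ] Calkin H

/-- An extension is trivial (split) if its Busby invariant lifts to a `⋆`-homomorphism into
`B(H)`. The lift need not be unital; if `X` is non-empty it can always be made unital. -/
def IsTrivial (τ : Busby X H) : Prop :=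
  ∃ φ : C(X, ℂ) →⋆ₙₐ[ℂ] (H →L[ℂ] H), ∀ f, Calkin.mk H (φ f) = τ f

/-- Unitary equivalence of extensions: `u σ(f) u⋆ = τ(f)` for a unitary operator `u`. -/
def UnitaryEquiv (σ : Busby X H) (τ : Busby X K) : Prop :=
  ∃ u : H →L[ℂ] K, adjoint u ∘L u = .id ℂ H ∧ u ∘L adjoint u = .id ℂ K ∧
    ∀ f, Calkin.conj u (σ f) = τ f

/-- The direct sum `σ ⊕ τ : C(X) → 𝒞(H ⊕ K)` of two extensions. -/
def directSum (σ : Busby X H) (τ : Busby X K) : Busby X (WithLp 2 (H × K)) where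
  toFun f := Calkin.conj (inl H K) (σ f) + Calkin.conj (inr H K) (τ f)
  map_one' := by
    rw [map_one σ, map_one τ, Calkin.conj_one, Calkin.conj_one, ← map_add, inl_add_inr]
    rfl
  map_mul' f g := by
    rw [map_mul σ, map_mul τ, Calkin.conj_mul adjoint_inl_inl, Calkin.conj_mul adjoint_inr_inr,
      add_mul, mul_add, mul_add, Calkin.conj_mul_conj adjoint_inl_inr,
      Calkin.conj_mul_conj adjoint_inr_inl, add_zero, zero_add]
  map_zero' := by simp
  map_add' f g := by simp only [map_add]; abel
  commutes' c := by
    rw [Algebra.algebraMap_eq_smul_one, map_smul, map_smul, map_smul, map_smul, ← smul_add,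
      Algebra.algebraMap_eq_smul_one, map_one σ, map_one τ, Calkin.conj_one, Calkin.conj_one,
      ← map_add, inl_add_inr]
    rfl
  map_star' f := by simp only [map_star, Calkin.conj_star, star_add]

theorem directSum_apply (σ : Busby X H) (τ : Busby X K) (f : C(X, ℂ)) : directSum σ τ f =
    Calkin.conj (inl H K) (σ f) + Calkin.conj (inr H K) (τ f) := rfl

theorem directSum_comp {Y : Type*} [TopologicalSpace Y] (σ : Busby X H) (τ : Busby X K)
    (g : C(X, Y)) : (directSum σ τ).comp (g.compStarAlgHom' ℂ ℂ) =
      directSum (σ.comp (g.compStarAlgHom' ℂ ℂ)) (τ.comp (g.compStarAlgHom' ℂ ℂ)) :=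
  StarAlgHom.ext fun _ => rfl

/-- The block-diagonal sum of two representations of `C(X)` on Hilbert spaces. -/
def directSumRep (φ : C(X, ℂ) →⋆ₙₐ[ℂ] (H →L[ℂ] H)) (ψ : C(X, ℂ) →⋆ₙₐ[ℂ] (K →L[ℂ] K)) :
    C(X, ℂ) →⋆ₙₐ[ℂ] (WithLp 2 (H × K) →L[ℂ] WithLp 2 (H × K)) where
  toFun f := inl H K ∘L φ f ∘L adjoint (inl H K) + inr H K ∘L ψ f ∘L adjoint (inr H K)
  map_smul' c f := by
    simp only [map_smul, smul_comp, comp_smul, smul_add, MonoidHom.id_apply]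
  map_zero' := by simp only [map_zero, zero_comp, comp_zero, add_zero]
  map_add' f g := by simp only [map_add, add_comp, comp_add]; abel
  map_mul' f g := by
    refine ContinuousLinearMap.ext fun x => ofLp_injective 2 (Prod.ext ?_ ?_) <;> simp [mul_def]
  map_star' f := by
    rw [star_eq_adjoint, map_add]
    simp only [map_star, star_eq_adjoint, adjoint_comp, adjoint_adjoint, comp_assoc]

theorem IsTrivial.directSum {σ : Busby X H} {τ : Busby X K} (hσ : IsTrivial σ)
    (hτ : IsTrivial τ) : IsTrivial (directSum σ τ) := by
  obtain ⟨φ, hφ⟩ := hσ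
  obtain ⟨ψ, hψ⟩ := hτ
  refine ⟨directSumRep φ ψ, fun f => ?_⟩
  rw [directSum_apply, ← hφ, ← hψ, Calkin.conj_mk, Calkin.conj_mk, ← map_add]
  rfl

namespace UnitaryEquiv

theorem refl (σ : Busby X H) : UnitaryEquiv σ σ :=
  ⟨.id ℂ H, by rw [adjoint_id, comp_id], by rw [adjoint_id, comp_id],
    fun f => Calkin.conj_id _⟩

theorem symm {σ : Busby X H} {τ : Busby X K} : UnitaryEquiv σ τ → UnitaryEquiv τ σ := by
  rintro ⟨u, h1, h2, h⟩
  refine ⟨adjoint u, by rw [adjoint_adjoint, h2], by rw [adjoint_adjoint, h1], fun f => ?_⟩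
  rw [← h, Calkin.conj_conj, h1, Calkin.conj_id]

theorem trans {σ : Busby X H} {τ : Busby X K} {ρ : Busby X L} :
    UnitaryEquiv σ τ → UnitaryEquiv τ ρ → UnitaryEquiv σ ρ := by
  rintro ⟨u, h1, h2, h⟩ ⟨v, k1, k2, k⟩
  refine ⟨v ∘L u, ?_, ?_, fun f => ?_⟩
  · rw [adjoint_comp, comp_assoc, ← comp_assoc (adjoint v) v u, k1, id_comp, h1]
  · rw [adjoint_comp, comp_assoc, ← comp_assoc u (adjoint u) (adjoint v), h2, id_comp, k2]
  · rw [← k, ← h, Calkin.conj_conj]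

/-- Two isometries with complementary ranges intertwining `σ` and `τ` with `ρ` exhibit `ρ` as the
direct sum of `σ` and `τ`. -/
theorem of_isometries {ρ : Busby X L} {σ : Busby X H} {τ : Busby X K}
    (i : H →L[ℂ] L) (j : K →L[ℂ] L)
    (hi : adjoint i ∘L i = .id ℂ H) (hj : adjoint j ∘L j = .id ℂ K)
    (hij : adjoint i ∘L j = 0) (h1 : i ∘L adjoint i + j ∘L adjoint j = .id ℂ L)
    (h : ∀ f, ρ f = Calkin.conj i (σ f) + Calkin.conj j (τ f)) :
    UnitaryEquiv (directSum σ τ) ρ := by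
  have hji : adjoint j ∘L i = 0 := by
    rw [← adjoint_adjoint i, ← adjoint_comp, hij, map_zero]
  have e1 (x) : adjoint i (i x) = x := DFunLike.congr_fun hi x
  have e2 (x) : adjoint j (j x) = x := DFunLike.congr_fun hj x
  have e3 (x) : adjoint i (j x) = 0 := DFunLike.congr_fun hij x
  have e4 (x) : adjoint j (i x) = 0 := DFunLike.congr_fun hji x
  have e5 (x) : i (adjoint i x) + j (adjoint j x) = x := DFunLike.congr_fun h1 x
  have hu : adjoint (i ∘L adjoint (inl H K) + j ∘L adjoint (inr H K)) =
      inl H K ∘L adjoint i + inr H K ∘L adjoint j := by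
    rw [map_add, adjoint_comp, adjoint_comp, adjoint_adjoint, adjoint_adjoint]
  refine ⟨i ∘L adjoint (inl H K) + j ∘L adjoint (inr H K), ?_, ?_, fun f => ?_⟩
  · rw [hu]
    refine ContinuousLinearMap.ext fun x => ofLp_injective 2 (Prod.ext ?_ ?_) <;>
      simp [e1, e2, e3, e4]
  · rw [hu]
    ext x
    simp [e5]
  · rw [directSum_apply, map_add, Calkin.conj_conj, Calkin.conj_conj, h, add_comp, add_comp,
      comp_assoc, comp_assoc, comp_assoc, comp_assoc, adjoint_inl_inl, adjoint_inr_inr,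
      adjoint_inl_inr, adjoint_inr_inl]
    simp only [comp_id, comp_zero, add_zero, zero_add]

theorem sum_comm (σ : Busby X H) (τ : Busby X K) :
    UnitaryEquiv (directSum σ τ) (directSum τ σ) :=
  of_isometries (inr K H) (inl K H) adjoint_inr_inr adjoint_inl_inl
    adjoint_inr_inl ((add_comm _ _).trans inl_add_inr) fun f => by
      rw [directSum_apply, add_comm]

theorem sum_congr {σ : Busby X H} {σ' : Busby X H'} {τ : Busby X K} {τ' : Busby X K'} :
    UnitaryEquiv σ σ' → UnitaryEquiv τ τ' →
      UnitaryEquiv (directSum σ τ) (directSum σ' τ') := by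
  rintro ⟨u, h1, h2, h⟩ ⟨v, k1, k2, k⟩
  have a1 (x) : adjoint u (u x) = x := DFunLike.congr_fun h1 x
  have a2 (x) : u (adjoint u x) = x := DFunLike.congr_fun h2 x
  have b1 (x) : adjoint v (v x) = x := DFunLike.congr_fun k1 x
  have b2 (x) : v (adjoint v x) = x := DFunLike.congr_fun k2 x
  refine of_isometries (inl H' K' ∘L u) (inr H' K' ∘L v) ?_ ?_ ?_ ?_ fun f => ?_
  · ext x; simp [adjoint_comp, a1]
  · ext x; simp [adjoint_comp, b1]
  · ext x; simp [adjoint_comp]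
  · refine ContinuousLinearMap.ext fun x => ofLp_injective 2 (Prod.ext ?_ ?_) <;>
      simp [adjoint_comp, a2, b2]
  · rw [directSum_apply, ← h, ← k, Calkin.conj_conj, Calkin.conj_conj]

theorem sum_assoc (σ : Busby X H) (τ : Busby X K) (ρ : Busby X L) :
    UnitaryEquiv (directSum (directSum σ τ) ρ) (directSum σ (directSum τ ρ)) := by
  let i : WithLp 2 (H × K) →L[ℂ] WithLp 2 (H × WithLp 2 (K × L)) :=
    inl _ _ ∘L adjoint (inl H K) + inr _ _ ∘L inl K L ∘L adjoint (inr H K)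
  let j : L →L[ℂ] WithLp 2 (H × WithLp 2 (K × L)) := inr _ _ ∘L inr K L
  have hi : adjoint i = inl H K ∘L adjoint (inl _ _) +
      inr H K ∘L adjoint (inl K L) ∘L adjoint (inr _ _) := by
    simp only [i, map_add, adjoint_comp, adjoint_adjoint, comp_assoc]
  have hj : adjoint j = adjoint (inr K L) ∘L adjoint (inr _ _) := by
    simp only [j, adjoint_comp]
  have hil : i ∘L inl H K = inl _ _ := by ext x; simp [i]
  have hir : i ∘L inr H K = inr _ _ ∘L inl K L := by ext x; simp [i]
  refine of_isometries i j ?_ ?_ ?_ ?_ fun f => ?_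
  · rw [hi]
    refine ContinuousLinearMap.ext fun x => ofLp_injective 2 (Prod.ext ?_ ?_) <;> simp [i]
  · rw [hj]; ext x; simp [j]
  · rw [hi]
    refine ContinuousLinearMap.ext fun x => ofLp_injective 2 (Prod.ext ?_ ?_) <;> simp [j]
  · rw [hi, hj]
    refine ContinuousLinearMap.ext fun x => ofLp_injective 2 (Prod.ext ?_
      (ofLp_injective 2 (Prod.ext ?_ ?_))) <;> simp [i, j]
  · simp only [directSum_apply, map_add, Calkin.conj_conj]
    rw [hil, hir, add_assoc]

end UnitaryEquiv

end Busby

/-! ### The odd K-homology `K₁(X)` -/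

/-- A unital extension of `C(X)` by the compact operators of some Hilbert space. -/
structure Extension (X : Type v) [TopologicalSpace X] where
  /-- The Hilbert space. -/
  H : Type u
  [normed : NormedAddCommGroup H]
  [inner : InnerProductSpace ℂ H]
  [complete : CompleteSpace H]
  /-- The Busby invariant. -/
  τ : Busby X H

attribute [instance] Extension.normed Extension.inner Extension.complete

section K₁

variable {X : Type v} [TopologicalSpace X] {Y : Type*} [TopologicalSpace Y]

/-- The extension on the zero Hilbert space. -/
def zeroBusby (X : Type v) [TopologicalSpace X] : Busby X PUnit.{u + 1} :=
  haveI : Subsingleton (Calkin PUnit.{u + 1}) := Calkin.mk_surjective.subsingleton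
  { toFun := 0
    map_one' := Subsingleton.elim _ _
    map_mul' := fun _ _ => Subsingleton.elim _ _
    map_zero' := rfl
    map_add' := fun _ _ => Subsingleton.elim _ _
    commutes' := fun _ => Subsingleton.elim _ _
    map_star' := fun _ => Subsingleton.elim _ _ }

theorem isTrivial_zeroBusby : IsTrivial (zeroBusby.{u} X) := ⟨0, fun _ => map_zero _⟩

namespace Extension

/-- Stable equivalence: two extensions are identified if they become unitarily equivalent after
adding trivial extensions. -/
def StablyEquiv (E F : Extension.{u} X) : Prop :=
  ∃ R S : Extension.{u} X, IsTrivial R.τ ∧ IsTrivial S.τ ∧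
    UnitaryEquiv (directSum E.τ R.τ) (directSum F.τ S.τ)

/-- The direct sum of two extensions. -/
def sum (E F : Extension.{u} X) : Extension.{u} X := ⟨_, directSum E.τ F.τ⟩

theorem StablyEquiv.of_unitaryEquiv {E F : Extension.{u} X} (h : UnitaryEquiv E.τ F.τ) :
    E.StablyEquiv F :=
  ⟨⟨_, zeroBusby X⟩, ⟨_, zeroBusby X⟩, isTrivial_zeroBusby, isTrivial_zeroBusby,
    h.sum_congr (.refl _)⟩

theorem StablyEquiv.symm {E F : Extension.{u} X} : E.StablyEquiv F → F.StablyEquiv E := by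
  rintro ⟨R, S, hR, hS, h⟩
  exact ⟨S, R, hS, hR, h.symm⟩

theorem StablyEquiv.trans {E F G : Extension.{u} X} :
    E.StablyEquiv F → F.StablyEquiv G → E.StablyEquiv G := by
  rintro ⟨R, S, hR, hS, h⟩ ⟨R', S', hR', hS', h'⟩
  refine ⟨⟨_, directSum R.τ R'.τ⟩, ⟨_, directSum S'.τ S.τ⟩, hR.directSum hR', hS'.directSum hS, ?_⟩
  have e1 := (UnitaryEquiv.sum_assoc E.τ R.τ R'.τ).symm.trans (h.sum_congr (.refl R'.τ))
  have e2 := (UnitaryEquiv.sum_assoc F.τ S.τ R'.τ).trans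
    ((UnitaryEquiv.refl F.τ).sum_congr (.sum_comm S.τ R'.τ))
  have e3 := (UnitaryEquiv.sum_assoc F.τ R'.τ S.τ).symm.trans (h'.sum_congr (.refl S.τ))
  exact e1.trans (e2.trans (e3.trans (.sum_assoc _ _ _)))

theorem StablyEquiv.sum {E E' F F' : Extension.{u} X} :
    E.StablyEquiv E' → F.StablyEquiv F' → (E.sum F).StablyEquiv (E'.sum F') := by
  have swap (A B C D : Extension.{u} X) : UnitaryEquiv
      (directSum (directSum A.τ B.τ) (directSum C.τ D.τ))
      (directSum (directSum A.τ C.τ) (directSum B.τ D.τ)) := by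
    refine (UnitaryEquiv.sum_assoc _ _ _).trans (.trans ?_ (UnitaryEquiv.sum_assoc _ _ _).symm)
    refine (UnitaryEquiv.refl _).sum_congr ?_
    refine (UnitaryEquiv.sum_assoc _ _ _).symm.trans (.trans ?_ (UnitaryEquiv.sum_assoc _ _ _))
    exact (UnitaryEquiv.sum_comm _ _).sum_congr (.refl _)
  rintro ⟨R, S, hR, hS, h⟩ ⟨R', S', hR', hS', h'⟩
  refine ⟨⟨_, directSum R.τ R'.τ⟩, ⟨_, directSum S.τ S'.τ⟩, hR.directSum hR', hS.directSum hS', ?_⟩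
  exact (swap E F R R').trans ((h.sum_congr h').trans (swap E' S F' S'))

/-- Extensions of `C(X)` up to stable equivalence. -/
instance setoid (X : Type v) [TopologicalSpace X] : Setoid (Extension.{u} X) where
  r := StablyEquiv
  iseqv := ⟨fun E => .of_unitaryEquiv (.refl E.τ), .symm, .trans⟩

/-- The push-forward `f ↦ τ(f ∘ g)` of an extension of `C(X)` along a continuous map
`g : X → Y`. -/
def map (g : C(X, Y)) (E : Extension.{u} X) : Extension.{u} Y :=
  ⟨E.H, E.τ.comp (g.compStarAlgHom' ℂ ℂ)⟩

theorem map_sum (g : C(X, Y)) (E F : Extension.{u} X) :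
    (E.sum F).map g = (E.map g).sum (F.map g) :=
  congrArg (Extension.mk (WithLp 2 (E.H × F.H))) (directSum_comp E.τ F.τ g)

theorem StablyEquiv.map (g : C(X, Y)) {E F : Extension.{u} X} :
    E.StablyEquiv F → (E.map g).StablyEquiv (F.map g) := by
  rintro ⟨R, S, ⟨φ, hφ⟩, ⟨ψ, hψ⟩, u, h1, h2, h⟩
  exact ⟨R.map g, S.map g,
    ⟨φ.comp (g.compStarAlgHom' ℂ ℂ : C(Y, ℂ) →⋆ₙₐ[ℂ] C(X, ℂ)), fun f => hφ _⟩,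
    ⟨ψ.comp (g.compStarAlgHom' ℂ ℂ : C(Y, ℂ) →⋆ₙₐ[ℂ] C(X, ℂ)), fun f => hψ _⟩,
    u, h1, h2, fun f => h (f.comp g)⟩

end Extension

/-- The odd K-homology `K₁(X) = Ext(X)` of Brown, Douglas and Fillmore of a compact metrizable
space `X`: unital extensions of `C(X)` by compact operators modulo unitary equivalence and trivial
extensions. The Busby invariants need not be injective and the Hilbert spaces need not be
infinite-dimensional or separable; this does not change the group, since adding a faithful trivial
extension makes an extension injective, and every extension of the separable algebra `C(X)` is the
direct sum of one on a separable Hilbert space and a trivial one. That the commutative monoid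
`K₁(X)` is a group (for `X` compact metrizable) is a theorem, which is not needed to state
equations in it. -/
def K₁ (X : Type v) [TopologicalSpace X] : Type _ := Quotient (Extension.setoid.{u} X)

namespace K₁

/-- The class `[τ] ∈ K₁(X)` of a unital `⋆`-homomorphism `τ : C(X) → 𝒞(H)`. -/
def mk {H : Type u} [NormedAddCommGroup H] [InnerProductSpace ℂ H] [CompleteSpace H]
    (τ : Busby X H) : K₁.{u} X := Quotient.mk _ ⟨H, τ⟩

instance : Zero (K₁.{u} X) := ⟨mk (zeroBusby X)⟩

instance : Add (K₁.{u} X) := ⟨Quotient.map₂ Extension.sum fun _ _ h _ _ k => h.sum k⟩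

/-- Addition in `K₁(X)` is the direct sum of extensions; trivial extensions represent zero. -/
instance : AddCommMonoid (K₁.{u} X) where
  nsmul := nsmulRec
  add_assoc := by
    rintro ⟨E⟩ ⟨F⟩ ⟨G⟩
    exact Quotient.sound (Extension.StablyEquiv.of_unitaryEquiv (.sum_assoc E.τ F.τ G.τ))
  add_comm := by
    rintro ⟨E⟩ ⟨F⟩
    exact Quotient.sound (Extension.StablyEquiv.of_unitaryEquiv (.sum_comm E.τ F.τ))
  zero_add := by
    rintro ⟨E⟩
    refine Quotient.sound ⟨⟨_, zeroBusby X⟩, ⟨_, directSum (zeroBusby.{u} X) (zeroBusby.{u} X)⟩,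
      isTrivial_zeroBusby, isTrivial_zeroBusby.directSum isTrivial_zeroBusby, ?_⟩
    exact (UnitaryEquiv.sum_comm (zeroBusby X) E.τ).sum_congr (.refl (zeroBusby X)) |>.trans
      (.sum_assoc _ _ _)
  add_zero := by
    rintro ⟨E⟩
    refine Quotient.sound ⟨⟨_, zeroBusby X⟩, ⟨_, directSum (zeroBusby.{u} X) (zeroBusby.{u} X)⟩,
      isTrivial_zeroBusby, isTrivial_zeroBusby.directSum isTrivial_zeroBusby, ?_⟩
    exact UnitaryEquiv.sum_assoc _ _ _

/-- The push-forward `g_* : K₁(X) → K₁(Y)` along a continuous map `g : X → Y`. -/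
def map (g : C(X, Y)) : K₁.{u} X →+ K₁.{u} Y where
  toFun := Quotient.map (Extension.map g) fun _ _ h => h.map g
  map_zero' := Quotient.sound (Extension.StablyEquiv.of_unitaryEquiv (.refl _))
  map_add' := by
    rintro ⟨E⟩ ⟨F⟩
    exact congrArg (Quotient.mk _) (Extension.map_sum g E F)

theorem mk_eq_zero_of_isTrivial {H : Type u} [NormedAddCommGroup H] [InnerProductSpace ℂ H]
    [CompleteSpace H] {τ : Busby X H} (h : IsTrivial τ) : mk τ = 0 :=
  Quotient.sound ⟨⟨_, zeroBusby X⟩, ⟨_, τ⟩, isTrivial_zeroBusby, h, .sum_comm _ _⟩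

end K₁

end K₁

/-! ### Essentially normal Hilbert modules over `ℂ[z₁, …, z_m]` -/

section HilbertModule

variable {m : ℕ} {M : Type*} [NormedAddCommGroup M] [InnerProductSpace ℂ M] [CompleteSpace M]

variable (m M) in
/-- A Hilbert module over the polynomial algebra `A = ℂ[z₁, …, z_m]` on the Hilbert space `M`: a
unital representation `p ↦ T_p` of `A` by bounded operators on `M`. -/
abbrev HilbertModule : Type _ := MvPolynomial (Fin m) ℂ →ₐ[ℂ] (M →L[ℂ] M)

namespace HilbertModule

/-- Essential normality: the commutators `[T_{z_i}⋆, T_{z_j}]` are compact for all `i`, `j`. -/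
def IsEssentiallyNormal (T : HilbertModule m M) : Prop :=
  ∀ i j, IsCompactOperator
    (adjoint (T (.X i)) ∘L T (.X j) - T (.X j) ∘L adjoint (T (.X i)))

/-- The class of the operator `T_{z_i}` in the Calkin algebra. -/
def coord (T : HilbertModule m M) (i : Fin m) : Calkin M := Calkin.mk M (T (.X i))

/-- The image in the Calkin algebra of the unital C⋆-algebra `𝔗(M)` generated by the operators
`T_{z_i}`, that is, the unital C⋆-subalgebra `𝔗(M)/𝒦` generated by their classes. -/
def symbolAlgebra (T : HilbertModule m M) : StarSubalgebra ℂ (Calkin M) :=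
  (StarAlgebra.adjoin ℂ (Set.range T.coord)).topologicalClosure

instance (T : HilbertModule m M) : IsClosed (T.symbolAlgebra : Set (Calkin M)) :=
  StarSubalgebra.isClosed_topologicalClosure _

theorem coord_mem (T : HilbertModule m M) (i : Fin m) : T.coord i ∈ T.symbolAlgebra :=
  StarSubalgebra.le_topologicalClosure _ (StarAlgebra.subset_adjoin ℂ _ ⟨i, rfl⟩)

theorem IsEssentiallyNormal.mul_comm {T : HilbertModule m M} (hT : T.IsEssentiallyNormal)
    (x y : T.symbolAlgebra) : x * y = y * x := by
  have : IsMulCommutative (StarAlgebra.adjoin ℂ (Set.range T.coord)) := by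
    refine StarAlgebra.isMulCommutative_adjoin ℂ ?_ ?_
    · rintro _ ⟨i, rfl⟩ _ ⟨j, rfl⟩
      simp only [coord, ← map_mul, _root_.mul_comm]
    · rintro _ ⟨i, rfl⟩ _ ⟨j, rfl⟩
      simp only [coord, Calkin.star_mk, ← map_mul]
      refine (Calkin.mk_eq_mk.2 (hT j i)).symm
  let _ := StarSubalgebra.commRingTopologicalClosure
    (StarAlgebra.adjoin ℂ (Set.range T.coord)) fun a b => this.is_comm.comm a b
  exact _root_.mul_comm (G := (StarAlgebra.adjoin ℂ (Set.range T.coord)).topologicalClosure) x y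

/-- The symbol algebra of an essentially normal Hilbert module is a commutative C⋆-algebra. -/
abbrev IsEssentiallyNormal.commCStarAlgebra {T : HilbertModule m M}
    (hT : T.IsEssentiallyNormal) : CommCStarAlgebra T.symbolAlgebra where
  mul_comm := hT.mul_comm

/-- The point `(χ(T_{z_1}), …, χ(T_{z_m}))` of `ℂᵐ` given by a character `χ` of `𝔗(M)/𝒦`. -/
def charPoint (T : HilbertModule m M) (χ : WeakDual.characterSpace ℂ T.symbolAlgebra) :
    Fin m → ℂ := fun i => χ ⟨T.coord i, T.coord_mem i⟩

/-- The essential spectrum `σᵉ(M) ⊆ ℂᵐ`: the character space of the commutative C⋆-algebra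
`𝔗(M)/𝒦`, embedded in `ℂᵐ` by evaluation at the generators. -/
def essSpectrum (T : HilbertModule m M) : Set (Fin m → ℂ) := Set.range T.charPoint

theorem continuous_charPoint (T : HilbertModule m M) : Continuous T.charPoint :=
  continuous_pi fun i =>
    (WeakDual.eval_continuous (⟨T.coord i, T.coord_mem i⟩ : T.symbolAlgebra)).comp
      continuous_subtype_val

instance (T : HilbertModule m M) : CompactSpace T.essSpectrum :=
  isCompact_iff_compactSpace.1 (isCompact_range T.continuous_charPoint)

/-- The surjection from the character space of `𝔗(M)/𝒦` to the essential spectrum. -/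
def charMap (T : HilbertModule m M) :
    C(WeakDual.characterSpace ℂ T.symbolAlgebra, T.essSpectrum) where
  toFun χ := ⟨T.charPoint χ, χ, rfl⟩
  continuous_toFun := T.continuous_charPoint.subtype_mk _

/-- The extension `α : C(σᵉ(M)) → 𝒞(M)` defined by an essentially normal Hilbert module: the
inverse of the Gelfand isomorphism `𝔗(M)/𝒦 ≅ C(σᵉ(M))`, followed by the inclusion. -/
def symbolHom (T : HilbertModule m M) (hT : T.IsEssentiallyNormal) :
    Busby T.essSpectrum M :=
  letI := hT.commCStarAlgebra
  T.symbolAlgebra.subtype.comp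
    ((gelfandStarTransform T.symbolAlgebra).symm.toStarAlgHom.comp
      (T.charMap.compStarAlgHom' ℂ ℂ))

theorem symbolHom_coord (T : HilbertModule m M) (hT : T.IsEssentiallyNormal) (i : Fin m) :
    T.symbolHom hT ⟨fun z => z.1 i, (continuous_apply i).comp continuous_subtype_val⟩ = Calkin.mk M (T (.X i)) := by
  let _ := hT.commCStarAlgebra
  have : (gelfandStarTransform T.symbolAlgebra).symm
      ((⟨fun z => z.1 i, (continuous_apply i).comp continuous_subtype_val⟩ : C(T.essSpectrum, ℂ)).comp T.charMap) =
      ⟨T.coord i, T.coord_mem i⟩ := by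
    rw [StarAlgEquiv.symm_apply_eq]
    rfl
  exact congrArg Subtype.val this

theorem symbolHom_injective (T : HilbertModule m M) (hT : T.IsEssentiallyNormal) :
    Function.Injective (T.symbolHom hT) := by
  let _ := hT.commCStarAlgebra
  intro f g hfg
  have h : f.comp T.charMap = g.comp T.charMap :=
    (gelfandStarTransform T.symbolAlgebra).symm.injective (Subtype.ext hfg)
  ext ⟨_, χ, rfl⟩
  exact DFunLike.congr_fun h χ

end HilbertModule

end HilbertModule

end EssNormal

end

open EssNormal

/-! Exactness makes `W₁` and `W₂⋆` bounded below, so both have polar decompositions `W₁ = i|W₁|` and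
`W₂⋆ = j|W₂⋆|` with `i`, `j` isometric and the moduli invertible. The range of `i` is `ker W₂` and
that of `j` is its orthogonal complement, so `U = i⋆` and `V = j⋆` satisfy the unitary relations
exactly. What remains is that `i` and `j` intertwine the coordinate operators and their adjoints
modulo compacts.

The coordinate operators are normal in the Calkin algebra, so the Fuglede–Putnam theorem applies
there: an operator `A` with `AS = TA` modulo compacts also satisfies `AS⋆ = T⋆A`. Hence `A⋆A`, and
with it `|A|`, commutes with `S`, and cancelling `|A|` leaves `iS = Ti` (`EssEq.polar`). The same
theorem turns the module property of `W₂` into an essential one for `W₂⋆`.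

The projections `ii⋆` and `jj⋆` therefore commute with the symbol algebra of `M₂`, and compression
to each range is a `⋆`-homomorphism onto generators of the other symbol algebras (`compressionHom`).
Gelfand duality turns it into inclusion of spectra and restriction of functions (`conj_symbolHom`).
As the projections sum to `1`, `α₂` is block diagonal, which gives the K-homology identity. -/

noncomputable section

namespace EssNormal

/-! ### Operators modulo compacts: Fuglede–Putnam and polar decomposition. -/

section Essential

variable {H K L : Type*}
  [NormedAddCommGroup H] [InnerProductSpace ℂ H] [CompleteSpace H]
  [NormedAddCommGroup K] [InnerProductSpace ℂ K] [CompleteSpace K]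
  [NormedAddCommGroup L] [InnerProductSpace ℂ L] [CompleteSpace L]

/-- Equality of operators modulo compact operators. -/
def EssEq (a b : H →L[ℂ] K) : Prop := IsCompactOperator (a - b)

namespace EssEq

theorem of_eq {a b : H →L[ℂ] K} (h : a = b) : EssEq a b := by
  rw [EssEq, h, sub_self]; exact isCompactOperator_zero

theorem symm {a b : H →L[ℂ] K} (h : EssEq a b) : EssEq b a := by
  rw [EssEq, ← neg_sub]; exact h.neg

theorem trans {a b c : H →L[ℂ] K} (h : EssEq a b) (h' : EssEq b c) : EssEq a c := by
  rw [EssEq, ← sub_add_sub_cancel a b c]; exact IsCompactOperator.add h h'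

theorem comp_left {a b : H →L[ℂ] K} (c : K →L[ℂ] L) (h : EssEq a b) :
    EssEq (c ∘L a) (c ∘L b) := by
  rw [EssEq, ← comp_sub]; exact IsCompactOperator.clm_comp h c

theorem comp_right {a b : K →L[ℂ] L} (c : H →L[ℂ] K) (h : EssEq a b) :
    EssEq (a ∘L c) (b ∘L c) := by
  rw [EssEq, ← sub_comp]; exact IsCompactOperator.comp_clm h c

theorem adjoint {a b : H →L[ℂ] K} (h : EssEq a b) :
    EssEq (adjoint a) (ContinuousLinearMap.adjoint b) := by
  rw [EssEq, ← map_sub]; exact isCompactOperator_adjoint h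

theorem mk_eq {a b : H →L[ℂ] H} : Calkin.mk H a = Calkin.mk H b ↔ EssEq a b := Calkin.mk_eq_mk

end EssEq

/-- The **Fuglede–Putnam theorem** modulo compact operators. -/
theorem EssEq.fuglede_putnam {S : H →L[ℂ] H} {T : K →L[ℂ] K} {W : H →L[ℂ] K}
    (hS : EssEq (ContinuousLinearMap.adjoint S ∘L S) (S ∘L ContinuousLinearMap.adjoint S))
    (hT : EssEq (ContinuousLinearMap.adjoint T ∘L T) (T ∘L ContinuousLinearMap.adjoint T))
    (h : EssEq (W ∘L S) (T ∘L W)) :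
    EssEq (W ∘L ContinuousLinearMap.adjoint S) (ContinuousLinearMap.adjoint T ∘L W) := by
  have e1 (x : H) : ContinuousLinearMap.adjoint (inl H K) (inl H K x) = x := by simp
  -- To work inside a single C⋆-algebra, `S` and `T` become diagonal blocks `S ⊕ 0` and `0 ⊕ T` on
  -- `H ⊕ K`, and `W` the off-diagonal block from `H` to `K`.
  have ea : IsStarNormal (Calkin.conj (inl H K) (Calkin.mk H S)) := by
    rw [isStarNormal_iff, commute_iff_eq, ← Calkin.conj_star, ← Calkin.conj_mul adjoint_inl_inl,
      ← Calkin.conj_mul adjoint_inl_inl]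
    exact congrArg _ (EssEq.mk_eq.2 hS)
  have eb : IsStarNormal (Calkin.conj (inr H K) (Calkin.mk K T)) := by
    rw [isStarNormal_iff, commute_iff_eq, ← Calkin.conj_star, ← Calkin.conj_mul adjoint_inr_inr,
      ← Calkin.conj_mul adjoint_inr_inr]
    exact congrArg _ (EssEq.mk_eq.2 hT)
  have left (R : H →L[ℂ] H) : Calkin.mk _ (inr H K ∘L W ∘L ContinuousLinearMap.adjoint (inl H K)) *
      Calkin.conj (inl H K) (Calkin.mk H R) =
        Calkin.mk _ (inr H K ∘L (W ∘L R) ∘L ContinuousLinearMap.adjoint (inl H K)) := by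
    rw [Calkin.conj_mk, ← map_mul]
    congr 1
    ext x
    simp
  have right (R : K →L[ℂ] K) : Calkin.conj (inr H K) (Calkin.mk K R) *
      Calkin.mk _ (inr H K ∘L W ∘L ContinuousLinearMap.adjoint (inl H K)) =
        Calkin.mk _ (inr H K ∘L (R ∘L W) ∘L ContinuousLinearMap.adjoint (inl H K)) := by
    rw [Calkin.conj_mk, ← map_mul]
    congr 1
    ext x
    simp
  have key : SemiconjBy (Calkin.mk _ (inr H K ∘L W ∘L ContinuousLinearMap.adjoint (inl H K)))
      (Calkin.conj (inl H K) (Calkin.mk H S)) (Calkin.conj (inr H K) (Calkin.mk K T)) := by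
    rw [SemiconjBy, left, right]
    exact EssEq.mk_eq.2 ((h.comp_right _).comp_left _)
  -- This is Fuglede–Putnam in the Calkin algebra of `H ⊕ K`; the off-diagonal corner is then cut
  -- out again.
  have key' := (key.star_right ea eb).eq
  rw [← Calkin.conj_star, ← Calkin.conj_star, Calkin.star_mk, Calkin.star_mk, left, right,
    EssEq.mk_eq] at key'
  have := (key'.comp_left (ContinuousLinearMap.adjoint (inr H K))).comp_right (inl H K)
  convert this using 1 <;> ext x <;> simp

/-- An operator that commutes modulo compacts with `A⋆A` commutes modulo compacts with `|A|`. -/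
theorem EssEq.sqrt_comm {A : H →L[ℂ] K} {S : H →L[ℂ] H}
    (h : EssEq (S ∘L ContinuousLinearMap.adjoint A ∘L A) ((ContinuousLinearMap.adjoint A ∘L A) ∘L S)) :
    EssEq (S ∘L CFC.sqrt (ContinuousLinearMap.adjoint A ∘L A))
      (CFC.sqrt (ContinuousLinearMap.adjoint A ∘L A) ∘L S) := by
  let _ := CStarAlgebra.spectralOrder (Calkin H)
  let _ := CStarAlgebra.spectralOrderedRing (Calkin H)
  set B := ContinuousLinearMap.adjoint A ∘L A
  have hB : 0 ≤ B := (nonneg_iff_isPositive _).2 (isPositive_adjoint_comp_self A)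
  -- The quotient map preserves square roots: the image of `CFC.sqrt B` squares to the class of `B`,
  -- and it is positive because it has the form `r⋆r`.
  have hq : CFC.sqrt (Calkin.mk H B) = Calkin.mk H (CFC.sqrt B) := by
    refine CFC.sqrt_unique (by rw [← map_mul, CFC.sqrt_mul_sqrt_self B]) ?_
    obtain ⟨r, hr⟩ := CStarAlgebra.nonneg_iff_eq_star_mul_self.1 (CFC.sqrt_nonneg B)
    rw [hr, map_mul, map_star]
    exact star_mul_self_nonneg _
  rw [← EssEq.mk_eq] at h ⊢
  have hc : Commute (Calkin.mk H B) (Calkin.mk H S) := by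
    rw [commute_iff_eq, ← map_mul, ← map_mul]; exact h.symm
  have := (hc.cfcₙ_nnreal NNReal.sqrt).eq
  change CFC.sqrt (Calkin.mk H B) * _ = _ * CFC.sqrt (Calkin.mk H B) at this
  rw [hq, ← map_mul, ← map_mul] at this
  exact this.symm

/-- Polar decomposition of an operator that is bounded below: `A = i |A|` with `i` isometric and
`|A|` invertible. -/
theorem exists_polar {A : H →L[ℂ] K} {c : ℝ} (hc : 0 < c) (hA : ∀ x, c * ‖x‖ ≤ ‖A x‖) :
    ∃ (i : H →L[ℂ] K) (Q : H →L[ℂ] H), adjoint i ∘L i = .id ℂ H ∧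
      i ∘L CFC.sqrt (adjoint A ∘L A) = A ∧ CFC.sqrt (adjoint A ∘L A) ∘L Q = .id ℂ H := by
  set B := adjoint A ∘L A with hBdef
  have hB : 0 ≤ B := (nonneg_iff_isPositive _).2 (isPositive_adjoint_comp_self A)
  -- Coercivity: `⟨Bx, x⟩ = ‖Ax‖² ≥ c²‖x‖²`.
  have hu : IsUnit B := by
    refine isUnit_of_forall_le_norm_inner_map _ (c := (c ^ 2).toNNReal)
      (Real.toNNReal_pos.2 (pow_pos hc 2)) fun x => ?_
    have : inner ℂ (B x) x = (‖A x‖ : ℂ) ^ 2 := by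
      rw [hBdef, comp_apply, adjoint_inner_left, inner_self_eq_norm_sq_to_K]; rfl
    rw [this]
    have h1 : ‖(‖A x‖ : ℂ) ^ 2‖ = ‖A x‖ ^ 2 := by simp
    rw [h1]
    have := pow_le_pow_left₀ (by positivity) (hA x) 2
    rw [Real.coe_toNNReal _ (by positivity)]
    nlinarith
  obtain ⟨q, hq⟩ := (CFC.isUnit_sqrt_iff B hB).2 hu
  have hs : CFC.sqrt B * CFC.sqrt B = B := CFC.sqrt_mul_sqrt_self B hB
  have hsa : adjoint (CFC.sqrt B) = CFC.sqrt B := (CFC.sqrt_nonneg B).isSelfAdjoint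
  rw [← hq] at hs hsa ⊢
  have h1 : (q : H →L[ℂ] H) ∘L (↑q⁻¹ : H →L[ℂ] H) = .id ℂ H := q.mul_inv
  have h2 : (↑q⁻¹ : H →L[ℂ] H) ∘L (q : H →L[ℂ] H) = .id ℂ H := q.inv_mul
  -- With `q = |A|` self-adjoint and `q² = A⋆A`, the operator `i = Aq⁻¹` satisfies `i⋆i =
  -- (q⁻¹)⋆q²q⁻¹ = (q⁻¹)⋆q = 1`.
  refine ⟨A ∘L ↑q⁻¹, ↑q⁻¹, ?_, ?_, h1⟩
  · have h3 : adjoint (↑q⁻¹ : H →L[ℂ] H) ∘L (q : H →L[ℂ] H) = .id ℂ H := by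
      conv_lhs => rw [← hsa]
      rw [← adjoint_comp, h1, adjoint_id]
    rw [adjoint_comp, comp_assoc, ← comp_assoc _ A, ← hBdef, ← hs, mul_def, comp_assoc, h1,
      comp_id, h3]
  · rw [comp_assoc, h2, comp_id]

/-- The isometric part of an operator intertwining essentially normal operators intertwines them
modulo compacts. -/
theorem EssEq.polar {A i : H →L[ℂ] K} {Q S : H →L[ℂ] H} {T : K →L[ℂ] K}
    (hS : EssEq (ContinuousLinearMap.adjoint S ∘L S) (S ∘L ContinuousLinearMap.adjoint S))
    (hT : EssEq (ContinuousLinearMap.adjoint T ∘L T) (T ∘L ContinuousLinearMap.adjoint T))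
    (hi : i ∘L CFC.sqrt (ContinuousLinearMap.adjoint A ∘L A) = A)
    (hQ : CFC.sqrt (ContinuousLinearMap.adjoint A ∘L A) ∘L Q = .id ℂ H)
    (h : EssEq (A ∘L S) (T ∘L A)) : EssEq (i ∘L S) (T ∘L i) := by
  have h1 := (fuglede_putnam hS hT h).adjoint
  simp only [adjoint_comp, adjoint_adjoint] at h1
  -- Modulo compacts, `SA⋆A = A⋆TA = A⋆AS`; the first equality is the adjoint of Fuglede–Putnam.
  have h2 : EssEq (S ∘L ContinuousLinearMap.adjoint A ∘L A)
      ((ContinuousLinearMap.adjoint A ∘L A) ∘L S) :=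
    (h1.comp_right A).trans (h.symm.comp_left (ContinuousLinearMap.adjoint A))
  -- Modulo compacts, `iS|A| = i|A|S = AS = TA`; then `|A|` is cancelled by its right inverse `Q`.
  have h3 := ((h2.sqrt_comm.comp_left i).trans (by
    rw [← comp_assoc, hi]; exact h)).comp_right Q
  rw [comp_assoc i, comp_assoc S, hQ, comp_id, comp_assoc T] at h3
  have h4 : A ∘L Q = i := by
    conv_lhs => rw [← hi]
    rw [comp_assoc, hQ, comp_id]
  rwa [h4] at h3

end Essential

/-! ### Closedness of commutants and naturality of the Gelfand transform. -/

theorem isClosed_setOf_commute {A : Type*} [CStarAlgebra A] (p : A) :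
    IsClosed {x : A | Commute x p} :=
  isClosed_eq (continuous_mul_const p) (continuous_const_mul p)

/-- Naturality of Gelfand duality, in the inverse form in which `symbolHom` is built: `φ` acts on
functions as composition with the pull-back of characters. -/
theorem map_gelfandStarTransform_symm {A B : Type*} [CommCStarAlgebra A] [CommCStarAlgebra B]
    (φ : A →⋆ₐ[ℂ] B) (f : C(WeakDual.characterSpace ℂ A, ℂ))
    (g : C(WeakDual.characterSpace ℂ B, ℂ))
    (h : ∀ χ, g χ = f (WeakDual.CharacterSpace.compContinuousMap φ χ)) :
    φ ((gelfandStarTransform A).symm f) = (gelfandStarTransform B).symm g := by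
  obtain ⟨a, rfl⟩ : ∃ a, gelfandStarTransform A a = f := (gelfandStarTransform A).surjective f
  rw [StarAlgEquiv.symm_apply_apply, eq_comm, StarAlgEquiv.symm_apply_eq]
  ext χ
  exact h χ

/-! ### Compression of the Calkin algebra along an isometry. -/

section Compression

variable {H K : Type*}
  [NormedAddCommGroup H] [InnerProductSpace ℂ H] [CompleteSpace H]
  [NormedAddCommGroup K] [InnerProductSpace ℂ K] [CompleteSpace K]

theorem Calkin.continuous_conj (W : H →L[ℂ] K) : Continuous (Calkin.conj W) := by
  refine AddMonoidHomClass.continuous_of_bound (Calkin.conj W) (‖W‖ * ‖W‖) fun x => ?_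
  refine le_of_forall_pos_le_add fun ε hε => ?_
  -- The `+ 1` keeps the denominator positive when `W = 0`.
  obtain ⟨a, rfl, ha⟩ := Calkin.exists_norm_lt x (show 0 < ε / (‖W‖ * ‖W‖ + 1) by positivity)
  rw [Calkin.conj_mk]
  calc _ ≤ ‖W ∘L a ∘L adjoint W‖ := Calkin.norm_mk_le _
    _ ≤ ‖W‖ * (‖a‖ * ‖adjoint W‖) := (opNorm_comp_le _ _).trans (by gcongr; exact opNorm_comp_le _ _)
    _ = ‖W‖ * ‖W‖ * ‖a‖ := by rw [LinearIsometryEquiv.norm_map]; ring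
    _ ≤ ‖W‖ * ‖W‖ * (‖Calkin.mk H a‖ + ε / (‖W‖ * ‖W‖ + 1)) := by gcongr
    _ ≤ ‖W‖ * ‖W‖ * ‖Calkin.mk H a‖ + ε := by
      rw [mul_add]
      gcongr
      rw [mul_div_assoc', div_le_iff₀ (by positivity)]
      nlinarith

/-- The range projection of an isometry, in the Calkin algebra. -/
abbrev Calkin.rangeProj (i : K →L[ℂ] H) : Calkin H := Calkin.mk H (i ∘L adjoint i)

/-- With `p = ii⋆`, the product of compressions is `i⋆xpyi`. Moving `p` to the left of `x` lets `i⋆p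
= i⋆` absorb it, so only one factor has to commute with `p`. -/
theorem Calkin.conj_mul_of_commute {i : K →L[ℂ] H} (hi : adjoint i ∘L i = .id ℂ K)
    {x : Calkin H} (hx : Commute x (rangeProj i)) (y : Calkin H) :
    conj (adjoint i) (x * y) = conj (adjoint i) x * conj (adjoint i) y := by
  have h1 (x y : Calkin H) : conj (adjoint i) x * conj (adjoint i) y =
      conj (adjoint i) (x * rangeProj i * y) := by
    obtain ⟨a, rfl⟩ := mk_surjective x
    obtain ⟨b, rfl⟩ := mk_surjective y
    simp only [← map_mul, conj_mk, mul_def, comp_assoc, adjoint_adjoint]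
  have h2 (x : Calkin H) : conj (adjoint i) (rangeProj i * x) = conj (adjoint i) x := by
    obtain ⟨a, rfl⟩ := mk_surjective x
    simp only [← map_mul, conj_mk, mul_def, adjoint_adjoint, comp_assoc]
    rw [← comp_assoc (adjoint i) i, hi, id_comp]
  rw [h1, hx.eq, mul_assoc, h2]

theorem Calkin.conj_conj_adjoint (i : K →L[ℂ] H) (x : Calkin H) :
    conj i (conj (adjoint i) x) = rangeProj i * x * rangeProj i := by
  obtain ⟨a, rfl⟩ := mk_surjective x
  simp only [← map_mul, conj_mk, mul_def, adjoint_adjoint, comp_assoc]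

theorem Calkin.rangeProj_mul_self {i : K →L[ℂ] H} (hi : adjoint i ∘L i = .id ℂ K) :
    rangeProj i * rangeProj i = rangeProj i := by
  rw [← map_mul, mul_def, comp_assoc, ← comp_assoc (adjoint i) i, hi, id_comp]

theorem Calkin.star_rangeProj (i : K →L[ℂ] H) : star (rangeProj i) = rangeProj i := by
  rw [star_mk, adjoint_comp, adjoint_adjoint]

/-- The elements that commute with the range projection of `i` and whose compression along `i` lies
in `B`. -/
def compressionSubalgebra {i : K →L[ℂ] H} (hi : adjoint i ∘L i = .id ℂ K)
    (B : StarSubalgebra ℂ (Calkin K)) : StarSubalgebra ℂ (Calkin H) where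
  carrier := {x | Commute x (Calkin.rangeProj i) ∧ Calkin.conj (adjoint i) x ∈ B}
  mul_mem' := fun ha hb => ⟨ha.1.mul_left hb.1, by
    rw [Calkin.conj_mul_of_commute hi ha.1]; exact mul_mem ha.2 hb.2⟩
  add_mem' := fun ha hb => ⟨ha.1.add_left hb.1, by rw [map_add]; exact add_mem ha.2 hb.2⟩
  algebraMap_mem' c := by
    refine ⟨Algebra.commutes c _, ?_⟩
    rw [Algebra.algebraMap_eq_smul_one, map_smul, Calkin.conj_one, adjoint_adjoint, hi]
    exact B.smul_mem (one_mem B) c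
  star_mem' := fun ha => ⟨by
    have := ha.1.star_star
    rwa [Calkin.star_rangeProj] at this, by
    rw [Calkin.conj_star]; exact star_mem ha.2⟩

theorem isClosed_compressionSubalgebra {i : K →L[ℂ] H} (hi : adjoint i ∘L i = .id ℂ K)
    (B : StarSubalgebra ℂ (Calkin K)) (hB : IsClosed (B : Set (Calkin K))) :
    IsClosed (compressionSubalgebra hi B : Set (Calkin H)) :=
  (isClosed_setOf_commute (Calkin.rangeProj i)).inter
    (hB.preimage (Calkin.continuous_conj _))

end Compression

/-! ### Essentially intertwining isometries, symbol algebras and essential spectra. -/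

namespace HilbertModule

variable {m : ℕ} {M N : Type*} [NormedAddCommGroup M] [InnerProductSpace ℂ M] [CompleteSpace M]
  [NormedAddCommGroup N] [InnerProductSpace ℂ N] [CompleteSpace N]

variable {T : HilbertModule m M} {S : HilbertModule m N} {i : N →L[ℂ] M}

/-- The right-hand side is a closed `⋆`-subalgebra, so the generators suffice. For these, modulo
compacts, `Tii⋆ = iSi⋆ = ii⋆T`, where the second equality is the adjoint of `h'`, and `i⋆Ti = i⋆iS =
S`. -/
theorem symbolAlgebra_le_compressionSubalgebra
    (hi : adjoint i ∘L i = .id ℂ N)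
    (h : ∀ j, EssEq (i ∘L S (.X j)) (T (.X j) ∘L i))
    (h' : ∀ j, EssEq (i ∘L adjoint (S (.X j))) (adjoint (T (.X j)) ∘L i)) :
    T.symbolAlgebra ≤ compressionSubalgebra hi S.symbolAlgebra := by
  refine StarSubalgebra.topologicalClosure_minimal (StarAlgebra.adjoin_le ?_)
    (isClosed_compressionSubalgebra hi _ inferInstance)
  rintro _ ⟨j, rfl⟩
  have h1 := (h' j).adjoint
  simp only [adjoint_comp, adjoint_adjoint] at h1
  constructor
  · rw [commute_iff_eq, coord, ← map_mul, ← map_mul, EssEq.mk_eq]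
    have := ((h j).symm.comp_right (adjoint i)).trans (h1.comp_left i)
    simpa only [mul_def, comp_assoc] using this
  · have : Calkin.conj (adjoint i) (T.coord j) = S.coord j := by
      rw [coord, Calkin.conj_mk, coord, EssEq.mk_eq, adjoint_adjoint]
      have := (h j).symm.comp_left (adjoint i)
      rwa [← comp_assoc _ i, hi, id_comp] at this
    rw [this]
    exact S.coord_mem j

/-- Compression along an isometry that essentially intertwines two Hilbert modules, as a
homomorphism between their symbol algebras. -/
def compressionHom
    (hi : adjoint i ∘L i = .id ℂ N)
    (h : ∀ j, EssEq (i ∘L S (.X j)) (T (.X j) ∘L i))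
    (h' : ∀ j, EssEq (i ∘L adjoint (S (.X j))) (adjoint (T (.X j)) ∘L i)) : T.symbolAlgebra →⋆ₐ[ℂ] S.symbolAlgebra where
  toFun x := ⟨Calkin.conj (adjoint i) x.1, (symbolAlgebra_le_compressionSubalgebra hi h h' x.2).2⟩
  map_one' := Subtype.ext (by
    change Calkin.conj (adjoint i) (1 : Calkin M) = 1
    rw [Calkin.conj_one, adjoint_adjoint, hi]; rfl)
  map_mul' x y := Subtype.ext (Calkin.conj_mul_of_commute hi
    (symbolAlgebra_le_compressionSubalgebra hi h h' x.2).1 y.1)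
  map_zero' := Subtype.ext (map_zero _)
  map_add' x y := Subtype.ext (map_add _ x.1 y.1)
  commutes' c := Subtype.ext (by
    change Calkin.conj (adjoint i) (algebraMap ℂ (Calkin M) c) = algebraMap ℂ (Calkin N) c
    rw [Algebra.algebraMap_eq_smul_one, map_smul, Calkin.conj_one, adjoint_adjoint, hi,
      Algebra.algebraMap_eq_smul_one]; rfl)
  map_star' x := Subtype.ext (Calkin.conj_star _ x.1)

theorem compressionHom_coord
    (hi : adjoint i ∘L i = .id ℂ N)
    (h : ∀ j, EssEq (i ∘L S (.X j)) (T (.X j) ∘L i))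
    (h' : ∀ j, EssEq (i ∘L adjoint (S (.X j))) (adjoint (T (.X j)) ∘L i))
    (j : Fin m) : compressionHom hi h h' ⟨T.coord j, T.coord_mem j⟩ =
    ⟨S.coord j, S.coord_mem j⟩ := by
  refine Subtype.ext ?_
  change Calkin.conj (adjoint i) (Calkin.mk M (T (.X j))) = Calkin.mk N (S (.X j))
  rw [Calkin.conj_mk, EssEq.mk_eq, adjoint_adjoint]
  have := (h j).symm.comp_left (adjoint i)
  rwa [← comp_assoc _ i, hi, id_comp] at this

/-- Characters pull back along `compressionHom`, and since it sends coordinates to coordinates, the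
point of `ℂᵐ` does not change. -/
theorem essSpectrum_subset
    (hi : adjoint i ∘L i = .id ℂ N)
    (h : ∀ j, EssEq (i ∘L S (.X j)) (T (.X j) ∘L i))
    (h' : ∀ j, EssEq (i ∘L adjoint (S (.X j))) (adjoint (T (.X j)) ∘L i)) : S.essSpectrum ⊆ T.essSpectrum := by
  rintro _ ⟨χ, rfl⟩
  refine ⟨WeakDual.CharacterSpace.compContinuousMap (compressionHom hi h h') χ, ?_⟩
  funext j
  exact congrArg χ (compressionHom_coord hi h h' j)

/-- Naturality of Gelfand duality for `compressionHom`: its dual map on characters is, in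
coordinates, the inclusion of essential spectra, so it acts on functions by restriction. -/
theorem conj_symbolHom
    (hi : adjoint i ∘L i = .id ℂ N)
    (h : ∀ j, EssEq (i ∘L S (.X j)) (T (.X j) ∘L i))
    (h' : ∀ j, EssEq (i ∘L adjoint (S (.X j))) (adjoint (T (.X j)) ∘L i))
    (hT : T.IsEssentiallyNormal) (hS : S.IsEssentiallyNormal)
    (f : C(T.essSpectrum, ℂ)) : Calkin.conj (adjoint i) (T.symbolHom hT f) =
      S.symbolHom hS (f.comp (ContinuousMap.inclusion (essSpectrum_subset hi h h'))) := by
  let _ := hT.commCStarAlgebra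
  let _ := hS.commCStarAlgebra
  refine congrArg Subtype.val (map_gelfandStarTransform_symm (compressionHom hi h h')
    (f.comp T.charMap)
    ((f.comp (ContinuousMap.inclusion (essSpectrum_subset hi h h'))).comp S.charMap) fun χ => ?_)
  refine congrArg f (Subtype.ext (funext fun j => ?_))
  exact congrArg χ (compressionHom_coord hi h h' j).symm

theorem commute_symbolHom_rangeProj
    (hi : adjoint i ∘L i = .id ℂ N)
    (h : ∀ j, EssEq (i ∘L S (.X j)) (T (.X j) ∘L i))
    (h' : ∀ j, EssEq (i ∘L adjoint (S (.X j))) (adjoint (T (.X j)) ∘L i))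
    (hT : T.IsEssentiallyNormal) (f : C(T.essSpectrum, ℂ)) :
    Commute (T.symbolHom hT f) (Calkin.rangeProj i) :=
  (symbolAlgebra_le_compressionSubalgebra hi h h' (Subtype.prop _)).1

theorem IsEssentiallyNormal.adjoint_comp_self (hT : T.IsEssentiallyNormal) (j : Fin m) :
    EssEq (adjoint (T (.X j)) ∘L T (.X j)) (T (.X j) ∘L adjoint (T (.X j))) := hT j j

end HilbertModule

/-! ### Orthogonal splitting of a short exact sequence. -/

section Splitting

variable {M₁ M₂ M₃ : Type*}
  [NormedAddCommGroup M₁] [InnerProductSpace ℂ M₁] [CompleteSpace M₁]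
  [NormedAddCommGroup M₂] [InnerProductSpace ℂ M₂] [CompleteSpace M₂]
  [NormedAddCommGroup M₃] [InnerProductSpace ℂ M₃] [CompleteSpace M₃]

/-- The adjoint of a surjective operator is bounded below. -/
theorem exists_adjoint_bound_of_surjective {W : M₂ →L[ℂ] M₃} (hW : Function.Surjective W) :
    ∃ c > 0, ∀ y, c * ‖y‖ ≤ ‖adjoint W y‖ := by
  -- The open mapping theorem gives `y = Wx` with `‖x‖ ≤ C‖y‖`, so `‖y‖² = ⟨W⋆y, x⟩ ≤ C‖W⋆y‖‖y‖`;
  -- hence the constant `C⁻¹`.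
  obtain ⟨C, hC, h⟩ := W.exists_preimage_norm_le hW
  refine ⟨C⁻¹, inv_pos.2 hC, fun y => ?_⟩
  obtain ⟨x, rfl, hx⟩ := h y
  rw [inv_mul_le_iff₀ hC]
  rcases (norm_nonneg (W x)).eq_or_lt with h0 | h0
  · rw [← h0]; positivity
  have h1 : ‖W x‖ * ‖W x‖ ≤ ‖adjoint W (W x)‖ * ‖x‖ := by
    have := norm_inner_le_norm (𝕜 := ℂ) (adjoint W (W x)) x
    rw [adjoint_inner_left, inner_self_eq_norm_sq_to_K] at this
    simpa [sq] using this
  refine le_of_mul_le_mul_right ?_ h0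
  calc _ ≤ ‖adjoint W (W x)‖ * ‖x‖ := h1
    _ ≤ ‖adjoint W (W x)‖ * (C * ‖W x‖) := by gcongr
    _ = _ := by ring

/-- An injective operator with closed range is bounded below. -/
theorem exists_bound_of_exact {W₁ : M₁ →L[ℂ] M₂} {W₂ : M₂ →L[ℂ] M₃}
    (hinj : Function.Injective W₁) (hexact : Function.Exact W₁ W₂) :
    ∃ c > 0, ∀ x, c * ‖x‖ ≤ ‖W₁ x‖ := by
  have hr : IsClosed (Set.range W₁) := by
    have : Set.range W₁ = W₂ ⁻¹' {0} := Set.ext fun y => (hexact y).symm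
    rw [this]
    exact isClosed_singleton.preimage W₂.continuous
  obtain ⟨C, h⟩ := W₁.antilipschitz_of_injective_of_isClosed_range hinj hr
  -- The antilipschitz constant `C` may be `0`, so `C + 1` is inverted instead.
  refine ⟨(C + 1 : ℝ)⁻¹, by positivity, fun x => ?_⟩
  rw [inv_mul_le_iff₀ (by positivity)]
  have := h.le_mul_norm (map_zero W₁) x
  nlinarith [norm_nonneg (W₁ x)]

/-- The isometric parts of `W₁` and `W₂⋆`, for a short exact sequence `(W₁, W₂)`, have complementary
ranges. -/
theorem complementary_of_exact {W₁ : M₁ →L[ℂ] M₂} {W₂ : M₂ →L[ℂ] M₃} {i : M₁ →L[ℂ] M₂}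
    {j : M₃ →L[ℂ] M₂} {P Q : M₁ →L[ℂ] M₁} {R S : M₃ →L[ℂ] M₃}
    (hexact : Function.Exact W₁ W₂) (hi : adjoint i ∘L i = .id ℂ M₁)
    (hj : adjoint j ∘L j = .id ℂ M₃) (hP : i ∘L P = W₁) (hPQ : P ∘L Q = .id ℂ M₁)
    (hR : j ∘L R = adjoint W₂) (hRS : R ∘L S = .id ℂ M₃) :
    adjoint i ∘L j = 0 ∧ i ∘L adjoint i + j ∘L adjoint j = .id ℂ M₂ := by
  have hiW : W₁ ∘L Q = i := by rw [← hP, comp_assoc, hPQ, comp_id]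
  have hjW : adjoint W₂ ∘L S = j := by rw [← hR, comp_assoc, hRS, comp_id]
  have hW₂ : W₂ = adjoint R ∘L adjoint j := by rw [← adjoint_comp, hR, adjoint_adjoint]
  have hij : adjoint i ∘L j = 0 := by
    have : W₂ ∘L W₁ = 0 := by ext x; exact hexact.apply_apply_eq_zero x
    rw [← hjW, ← comp_assoc, ← adjoint_comp, ← hiW, ← comp_assoc, this]
    simp
  have hji : adjoint j ∘L i = 0 := by rw [← adjoint_adjoint i, ← adjoint_comp, hij, map_zero]
  have e1 (x) : adjoint i (i x) = x := DFunLike.congr_fun hi x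
  have e2 (x) : adjoint j (j x) = x := DFunLike.congr_fun hj x
  have e3 (x) : adjoint i (j x) = 0 := DFunLike.congr_fun hij x
  have e4 (x) : adjoint j (i x) = 0 := DFunLike.congr_fun hji x
  refine ⟨hij, ContinuousLinearMap.ext fun x => ?_⟩
  -- The residue `y` is orthogonal to the ranges of `i` and `j`. Orthogonality to the latter puts it
  -- in `ker W₂ = ran W₁`, which lies in the range of `i`, so `y = 0`.
  set y := x - (i (adjoint i x) + j (adjoint j x)) with hy
  have hy0 : W₂ y = 0 := by rw [hW₂]; simp [hy, e2, e4]
  obtain ⟨z, hz⟩ := (hexact y).1 hy0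
  have h1 : adjoint i y = 0 := by simp [hy, e1, e3]
  rw [← hP, comp_apply] at hz
  have h2 : P z = 0 := by rw [← e1 (P z), hz, h1]
  rw [h2, map_zero] at hz
  exact (sub_eq_zero.1 hz.symm).symm

/-- An element of the Calkin algebra that commutes with complementary projections is the sum of its
compressions. -/
theorem Calkin.eq_add_conj {i : M₁ →L[ℂ] M₂} {j : M₃ →L[ℂ] M₂}
    (hi : adjoint i ∘L i = .id ℂ M₁) (hj : adjoint j ∘L j = .id ℂ M₃)
    (hij : i ∘L adjoint i + j ∘L adjoint j = .id ℂ M₂) {x : Calkin M₂}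
    (hxi : Commute x (rangeProj i)) (hxj : Commute x (rangeProj j)) :
    x = conj i (conj (adjoint i) x) + conj j (conj (adjoint j) x) := by
  have h1 : rangeProj i + rangeProj j = 1 := by rw [← map_add, hij]; rfl
  -- With `p = ii⋆` and `q = jj⋆`, commutation gives `pxp + qxq = xp + xq = x`.
  rw [conj_conj_adjoint, conj_conj_adjoint, ← hxi.eq, ← hxj.eq, mul_assoc, mul_assoc,
    rangeProj_mul_self hi, rangeProj_mul_self hj, ← mul_add, h1, mul_one]

end Splitting

end EssNormal

end

/-! ### The theorem. -/

open EssNormal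

theorem corollary3p10 {m : ℕ} {M₁ M₂ M₃ : Type u}
    [NormedAddCommGroup M₁] [InnerProductSpace ℂ M₁] [CompleteSpace M₁]
    [NormedAddCommGroup M₂] [InnerProductSpace ℂ M₂] [CompleteSpace M₂]
    [NormedAddCommGroup M₃] [InnerProductSpace ℂ M₃] [CompleteSpace M₃]
    (T₁ : HilbertModule m M₁) (T₂ : HilbertModule m M₂) (T₃ : HilbertModule m M₃)
    (h₁ : T₁.IsEssentiallyNormal) (h₂ : T₂.IsEssentiallyNormal) (h₃ : T₃.IsEssentiallyNormal)
    (W₁ : M₁ →L[ℂ] M₂) (W₂ : M₂ →L[ℂ] M₃)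
    (hW₁ : ∀ p, W₁ ∘L T₁ p = T₂ p ∘L W₁) (hW₂ : ∀ p, W₂ ∘L T₂ p = T₃ p ∘L W₂)
    (hinj : Function.Injective W₁) (hexact : Function.Exact W₁ W₂)
    (hsurj : Function.Surjective W₂) :
    ∃ (s₁ : T₁.essSpectrum ⊆ T₂.essSpectrum) (s₃ : T₃.essSpectrum ⊆ T₂.essSpectrum)
      (U : M₂ →L[ℂ] M₁) (V : M₂ →L[ℂ] M₃),
      U ∘L adjoint U = .id ℂ M₁ ∧ V ∘L adjoint V = .id ℂ M₃ ∧
      U ∘L adjoint V = 0 ∧ V ∘L adjoint U = 0 ∧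
      adjoint U ∘L U + adjoint V ∘L V = .id ℂ M₂ ∧
      (∀ f, Calkin.conj U (T₂.symbolHom h₂ f) =
        T₁.symbolHom h₁ (f.comp (ContinuousMap.inclusion s₁))) ∧
      (∀ f, Calkin.conj V (T₂.symbolHom h₂ f) =
        T₃.symbolHom h₃ (f.comp (ContinuousMap.inclusion s₃))) ∧
      K₁.mk (T₂.symbolHom h₂) =
        K₁.map (ContinuousMap.inclusion s₁) (K₁.mk (T₁.symbolHom h₁)) +
        K₁.map (ContinuousMap.inclusion s₃) (K₁.mk (T₃.symbolHom h₃)) := by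
  obtain ⟨c, hc, hcb⟩ := exists_bound_of_exact hinj hexact
  obtain ⟨d, hd, hdb⟩ := exists_adjoint_bound_of_surjective hsurj
  obtain ⟨i, Q, hi, hP, hPQ⟩ := exists_polar hc hcb
  obtain ⟨j, S, hj, hR, hRS⟩ := exists_polar hd hdb
  obtain ⟨hij, hsum⟩ := complementary_of_exact hexact hi hj hP hPQ hR hRS
  have hji : adjoint j ∘L i = 0 := by rw [← adjoint_adjoint i, ← adjoint_comp, hij, map_zero]
  have n₁ := h₁.adjoint_comp_self
  have n₂ := h₂.adjoint_comp_self
  have n₃ := h₃.adjoint_comp_self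
  have ti (k) : EssEq (i ∘L T₁ (.X k)) (T₂ (.X k) ∘L i) :=
    EssEq.polar (n₁ k) (n₂ k) hP hPQ (.of_eq (hW₁ _))
  have ti' (k) := EssEq.fuglede_putnam (n₁ k) (n₂ k) (ti k)
  -- `W₂⋆` need not be a module map. Fuglede–Putnam gives `W₂T₂⋆ = T₃⋆W₂` modulo compacts, and the
  -- adjoint of this says that `W₂⋆` essentially intertwines `T₃` with `T₂`.
  have tj (k) : EssEq (j ∘L T₃ (.X k)) (T₂ (.X k) ∘L j) := by
    refine EssEq.polar (n₃ k) (n₂ k) hR hRS ?_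
    have := (EssEq.fuglede_putnam (n₂ k) (n₃ k) (.of_eq (hW₂ _))).adjoint
    simpa only [adjoint_comp, adjoint_adjoint] using this.symm
  have tj' (k) := EssEq.fuglede_putnam (n₃ k) (n₂ k) (tj k)
  have ci := HilbertModule.conj_symbolHom hi ti ti' h₂ h₁
  have cj := HilbertModule.conj_symbolHom hj tj tj' h₂ h₃
  refine ⟨HilbertModule.essSpectrum_subset hi ti ti', HilbertModule.essSpectrum_subset hj tj tj',
    adjoint i, adjoint j, by rwa [adjoint_adjoint], by rwa [adjoint_adjoint],
    by rwa [adjoint_adjoint], by rwa [adjoint_adjoint], by rwa [adjoint_adjoint, adjoint_adjoint],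
    ci, cj, ?_⟩
  -- The sum `α₁ ⊕ α₃`, pushed forward to the spectrum of `M₂`, is unitarily equivalent to `α₂`
  -- itself; stabilising by the zero extension is enough.
  refine Quotient.sound (Extension.StablyEquiv.of_unitaryEquiv (UnitaryEquiv.symm ?_))
  refine UnitaryEquiv.of_isometries i j hi hj hij hsum fun f => ?_
  refine (Calkin.eq_add_conj hi hj hsum
    (HilbertModule.commute_symbolHom_rangeProj hi ti ti' h₂ f)
    (HilbertModule.commute_symbolHom_rangeProj hj tj tj' h₂ f)).trans ?_
  rw [ci, cj]
  rfl
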